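/- Let $0 \le k \le n$ be integers and let $\varepsilon > 0$. Equip the torus $(\mathbb{R}/\mathbb{Z})^n$ with the flat $L^2$ metric $d(x,y) = \bigl(\sum_{i=1}^n \|x_i - y_i\|^2\bigr)^{1/2}$, where $\|t\|$ denotes the distance from $t$ to the nearest integer. Below, ``subgroup'' means closed subgroup of $(\mathbb{R}/\mathbb{Z})^n$, a subtorus is a connected closed subgroup, the dimension of a subgroup is its dimension as a Lie group (equivalently, the dimension of its identity component, which is a subtorus), and the volume of a $k$-dimensional subgroup is its $k$-dimensional volume with respect to the flat metric (the number of elements if $k = 0$). Then there exist a constant $C^* = C^*(n,k,\varepsilon) > 0$ and a finite list $L^* = L^*(n,k,\varepsilon)$ of subgroups of $(\mathbb{R}/\mathbb{Z})^n$ such that for each $k$-dimensional subgroup $\Delta$ of $(\mathbb{R}/\mathbb{Z})^n$, at least one of the following holds: 1. $\Delta$ has volume at most $C^*$. 2. $\Delta$ is contained in some $\Gamma \in L^*$ and is $\varepsilon$-dense in $\Gamma$, that is, every point of $\Gamma$ is at distance less than $\varepsilon$ from some point of $\Delta$. If moreover $\Delta$ is a subtorus, then $\Gamma$ can be taken to be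 a subtorus. Moreover, if $k < n$, then each subgroup in $L^*$ has dimension at least $k+1$. -/

import Mathlib

open scoped MeasureTheory

/-- The torus `(ℝ/ℤ)ⁿ` with its flat `L²` metric
`dist x y = √(∑ᵢ ‖xᵢ - yᵢ‖²)`, where `‖·‖` on `ℝ/ℤ` is the distance to the nearest integer. -/
abbrev Torus (n : ℕ) : Type := PiLp 2 (fun _ : Fin n => UnitAddCircle)

/-- The standard quotient map `π : ℝⁿ → (ℝ/ℤ)ⁿ`. -/
noncomputable def torusProj (n : ℕ) : EuclideanSpace ℝ (Fin n) →+ Torus n where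
  toFun v := WithLp.toLp 2 (fun i => ((v i : ℝ) : UnitAddCircle))
  map_zero' := by ext i; simp
  map_add' v w := by ext i; simp

/-- The tangent space at `0` (the Lie algebra) of a subgroup `Δ` of the torus: all directions
`v ∈ ℝⁿ` whose one-parameter subgroup `t ↦ π(t v)` stays in `Δ`. -/
def tangentSubspace {n : ℕ} (Δ : AddSubgroup (Torus n)) :
    Submodule ℝ (EuclideanSpace ℝ (Fin n)) where
  carrier := {v | ∀ t : ℝ, torusProj n (t • v) ∈ Δ}
  zero_mem' t := by simp
  add_mem' {v w} hv hw t := by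
    rw [smul_add, map_add]
    exact Δ.add_mem (hv t) (hw t)
  smul_mem' c v hv t := by
    rw [smul_smul]
    exact hv (t * c)

/-- The dimension of a closed subgroup of the torus (its dimension as a Lie group, that is, the
dimension of the subtorus which is its identity component). -/
noncomputable def torusDim {n : ℕ} (Δ : AddSubgroup (Torus n)) : ℕ :=
  Module.finrank ℝ (tangentSubspace Δ)

/-- A subtorus is a closed connected subgroup of the torus. -/
def IsSubtorus {n : ℕ} (Δ : AddSubgroup (Torus n)) : Prop :=
  IsClosed (Δ : Set (Torus n)) ∧ IsConnected (Δ : Set (Torus n))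

/-- The `k`-dimensional volume of a subgroup of the torus: its `k`-dimensional Hausdorff measure
for the flat `L²` metric, normalized to agree with Lebesgue measure on `ℝᵏ`
(for `k = 0` this is the number of elements). -/
noncomputable def torusVol {n : ℕ} (k : ℕ) (Δ : AddSubgroup (Torus n)) : ENNReal :=
  (μHE[k] : MeasureTheory.Measure (Torus n)) (Δ : Set (Torus n))

/-- `Δ` is `ε`-dense in `Γ`: every point of `Γ` is at `L²` distance less than `ε` from some
point of `Δ`. -/
def IsEpsDense {n : ℕ} (ε : ℝ) (Δ Γ : AddSubgroup (Torus n)) : Prop :=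
  ∀ y ∈ Γ, ∃ x ∈ Δ, dist y x < ε

open TopologicalSpace Topology Filter

/-! The closed subgroups form a closed, hence compact, subset of the space of nonempty compact sets
with the Hausdorff distance. Each closed Γ has a radius within which every closed subgroup lies
inside Γ, because the torus modulo Γ has no small subgroups. Finitely many such balls, shrunk to
radius at most ε, cover everything, so every Δ is ε-dense in some Γ ⊇ Δ from a finite list. If dim Γ
> k, this is the second alternative. If dim Γ = k, then vol Δ ≤ vol Γ < ∞, and C* dominates these
finitely many volumes. -/

theorem torusProj_apply {n : ℕ} (v : EuclideanSpace ℝ (Fin n)) (i : Fin n) :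
    torusProj n v i = ((v i : ℝ) : UnitAddCircle) := rfl

theorem norm_torusProj_le {n : ℕ} (v : EuclideanSpace ℝ (Fin n)) : ‖torusProj n v‖ ≤ ‖v‖ := by
  rw [PiLp.norm_eq_of_L2, PiLp.norm_eq_of_L2]
  gcongr with i
  rw [torusProj_apply, UnitAddCircle.norm_eq, Real.norm_eq_abs]
  simpa using round_le (v i) 0

theorem exists_torusProj_eq_norm_eq {n : ℕ} (x : Torus n) :
    ∃ v, torusProj n v = x ∧ ‖v‖ = ‖x‖ := by
  have h : ∀ y : UnitAddCircle, ∃ t : ℝ, (t : UnitAddCircle) = y ∧ ‖t‖ = ‖y‖ := by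
    intro y
    obtain ⟨s, rfl⟩ := QuotientAddGroup.mk_surjective y
    refine ⟨s - round s, ?_, ?_⟩
    · have : ((round s : ℝ) : UnitAddCircle) = 0 :=
        AddCircle.coe_eq_zero_iff (1 : ℝ) |>.2 ⟨round s, by simp⟩
      rw [AddCircle.coe_sub, this, sub_zero]
    · exact (UnitAddCircle.norm_eq (x := s)).symm
  choose f hf hfn using h
  refine ⟨WithLp.toLp 2 fun i => f (x i), ?_, ?_⟩
  · ext i
    rw [torusProj_apply, hf]
  · rw [PiLp.norm_eq_of_L2, PiLp.norm_eq_of_L2]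
    simp [hfn]

theorem lipschitzWith_torusProj (n : ℕ) : LipschitzWith 1 (torusProj n) :=
  LipschitzWith.of_dist_le_mul fun v w => by
    simpa [dist_eq_norm, ← map_sub] using norm_torusProj_le (v - w)

instance compactSpace_torus (n : ℕ) : CompactSpace (Torus n) := by
  have : CompactSpace (∀ _ : Fin n, UnitAddCircle) := inferInstance
  exact (PiLp.homeomorph 2 (fun _ : Fin n => UnitAddCircle)).symm.compactSpace

/-! ### Tangent directions and absence of small subgroups -/

theorem torusProj_mem_of_mem_tangentSubspace {n : ℕ} {Δ : AddSubgroup (Torus n)}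
    {v : EuclideanSpace ℝ (Fin n)} (hv : v ∈ tangentSubspace Δ) : torusProj n v ∈ Δ := by
  simpa using hv 1

/-- A limit of directions of vectors of `π⁻¹(Δ)` tending to `0` is tangent to `Δ`. -/
theorem mem_tangentSubspace_of_tendsto {n : ℕ} {Δ : AddSubgroup (Torus n)}
    (hΔ : IsClosed (Δ : Set (Torus n))) {u : ℕ → EuclideanSpace ℝ (Fin n)}
    (hu : ∀ j, torusProj n (u j) ∈ Δ) (hlim : Tendsto u atTop (𝓝 0))
    {w : EuclideanSpace ℝ (Fin n)} (hw : Tendsto (fun j => ‖u j‖⁻¹ • u j) atTop (𝓝 w)) :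
    w ∈ tangentSubspace Δ := by
  intro t
  -- Integer multiples of `u j` stay in the preimage of Δ, and rounding `t / ‖u j‖` down costs less
  -- than `‖u j‖`.
  have hdiff : Tendsto (fun j => Int.fract (t / ‖u j‖) • u j) atTop (𝓝 0) := by
    refine squeeze_zero_norm (fun j => ?_) (by simpa using hlim.norm)
    rw [norm_smul, Real.norm_of_nonneg (Int.fract_nonneg _)]
    exact mul_le_of_le_one_left (norm_nonneg _) (Int.fract_lt_one _).le
  have hfl : Tendsto (fun j => ⌊t / ‖u j‖⌋ • u j) atTop (𝓝 (t • w)) := by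
    have := (hw.const_smul t).sub hdiff
    rw [sub_zero] at this
    refine this.congr fun j => ?_
    rw [smul_smul, ← div_eq_mul_inv, ← sub_smul, Int.self_sub_fract, Int.cast_smul_eq_zsmul]
  refine hΔ.mem_of_tendsto (((lipschitzWith_torusProj n).continuous.tendsto _).comp hfl)
    (Eventually.of_forall fun j => ?_)
  rw [Function.comp_apply, map_zsmul]
  exact Δ.zsmul_mem (hu j) _

/-- Every vector can be moved along the tangent space of `Δ`, without increasing its norm, to a vector
orthogonal to that space. -/
theorem exists_orthogonal_tangentSubspace {n : ℕ} (Δ : AddSubgroup (Torus n))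
    (v : EuclideanSpace ℝ (Fin n)) :
    ∃ u ∈ (tangentSubspace Δ)ᗮ, v - u ∈ tangentSubspace Δ ∧ ‖u‖ ≤ ‖v‖ := by
  refine ⟨(tangentSubspace Δ)ᗮ.starProjection v, Submodule.starProjection_apply_mem _ _, ?_,
    Submodule.norm_starProjection_apply_le _ _⟩
  rw [Submodule.starProjection_orthogonal_val, sub_sub_cancel]
  exact Submodule.starProjection_apply_mem _ _

/-- Near the identity, a closed subgroup of the torus consists of its tangent directions. -/
theorem exists_ball_subset_tangentSubspace {n : ℕ} {Δ : AddSubgroup (Torus n)}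
    (hΔ : IsClosed (Δ : Set (Torus n))) :
    ∃ δ > 0, ∀ v, torusProj n v ∈ Δ → ‖v‖ < δ → v ∈ tangentSubspace Δ := by
  -- Otherwise there are nonzero normal vectors `u j → 0` over Δ; a limit of their directions is a
  -- unit vector both tangent and normal.
  by_contra! h
  have h' : ∀ j : ℕ, ∃ u ∈ (tangentSubspace Δ)ᗮ,
      torusProj n u ∈ Δ ∧ u ≠ 0 ∧ ‖u‖ ≤ 1 / ((j : ℝ) + 1) := by
    intro j
    obtain ⟨v, hv, hvn, hvt⟩ := h (1 / ((j : ℝ) + 1)) (by positivity)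
    obtain ⟨u, hu, hvu, hun⟩ := exists_orthogonal_tangentSubspace Δ v
    refine ⟨u, hu, ?_, ?_, hun.trans hvn.le⟩
    · have := Δ.sub_mem hv (torusProj_mem_of_mem_tangentSubspace hvu)
      rwa [← map_sub, sub_sub_cancel] at this
    · rintro rfl
      exact hvt (by simpa using hvu)
  choose u hu hmem hu0 hun using h'
  have hlim : Tendsto u atTop (𝓝 0) :=
    squeeze_zero_norm hun tendsto_one_div_add_atTop_nhds_zero_nat
  obtain ⟨w, hw, φ, hφ, hφw⟩ := (isCompact_sphere (0 : EuclideanSpace ℝ (Fin n)) 1).tendsto_subseq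
    (x := fun j => ‖u j‖⁻¹ • u j) fun j => by
      simp [norm_smul, norm_ne_zero_iff.2 (hu0 j)]
  have hwt : w ∈ tangentSubspace Δ :=
    mem_tangentSubspace_of_tendsto hΔ (u := u ∘ φ) (fun j => hmem _)
      (hlim.comp hφ.tendsto_atTop) hφw
  have hwo : w ∈ (tangentSubspace Δ)ᗮ :=
    (Submodule.isClosed_orthogonal _).mem_of_tendsto hφw
      (Eventually.of_forall fun j => Submodule.smul_mem _ _ (hu _))
  have hw0 : w = 0 := by
    simpa using (Submodule.orthogonal_disjoint (tangentSubspace Δ)).le_bot ⟨hwt, hwo⟩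
  simp [hw0] at hw

/-- The quotient of the torus by a closed subgroup has no small subgroups. -/
theorem exists_forall_le_of_near {n : ℕ} {Γ : AddSubgroup (Torus n)}
    (hΓ : IsClosed (Γ : Set (Torus n))) :
    ∃ r > 0, ∀ H : AddSubgroup (Torus n), (∀ x ∈ H, ∃ y ∈ Γ, dist x y < r) → H ≤ Γ := by
  obtain ⟨δ, hδ, hloc⟩ := exists_ball_subset_tangentSubspace hΓ
  -- With thirds, `2u - u'` below has norm less than δ, so `hloc` applies.
  refine ⟨δ / 3, by positivity, fun H hH => ?_⟩
  have hrep : ∀ x ∈ H, ∃ u ∈ (tangentSubspace Γ)ᗮ, x - torusProj n u ∈ Γ ∧ ‖u‖ < δ / 3 := by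
    intro x hx
    obtain ⟨y, hy, hxy⟩ := hH x hx
    obtain ⟨v, hv, hvn⟩ := exists_torusProj_eq_norm_eq (x - y)
    obtain ⟨u, hu, hvu, hun⟩ := exists_orthogonal_tangentSubspace Γ v
    refine ⟨u, hu, ?_, by rw [dist_eq_norm] at hxy; linarith⟩
    have := Γ.add_mem hy (torusProj_mem_of_mem_tangentSubspace hvu)
    rwa [map_sub, hv, add_sub, add_sub_cancel] at this
  -- The short normal representative of `2x` must be `2u` itself, so smallness survives doubling;
  -- iterating forces `u = 0`.
  have hdouble : ∀ x ∈ H, ∀ u ∈ (tangentSubspace Γ)ᗮ, x - torusProj n u ∈ Γ → ‖u‖ < δ / 3 →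
      ‖(2 : ℕ) • u‖ < δ / 3 := by
    intro x hx u hu hxu hun
    obtain ⟨u', hu', hxu', hun'⟩ := hrep _ (H.nsmul_mem hx 2)
    have hmem : torusProj n ((2 : ℕ) • u - u') ∈ Γ := by
      have := Γ.sub_mem hxu' (Γ.nsmul_mem hxu 2)
      rw [map_sub, map_nsmul]
      convert this using 1
      rw [nsmul_sub]
      abel
    have hsmall : ‖(2 : ℕ) • u - u'‖ < δ := by
      have h1 := norm_sub_le ((2 : ℕ) • u) u'
      have h2 : ‖(2 : ℕ) • u‖ ≤ 2 * ‖u‖ := by simpa using norm_nsmul_le (n := 2) (a := u)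
      linarith
    have h0 : (2 : ℕ) • u - u' = 0 := by
      simpa using (Submodule.orthogonal_disjoint (tangentSubspace Γ)).le_bot
        ⟨hloc _ hmem hsmall, Submodule.sub_mem _ (Submodule.smul_of_tower_mem _ 2 hu) hu'⟩
    rwa [sub_eq_zero.1 h0]
  intro x hx
  obtain ⟨u, hu, hxu, hun⟩ := hrep x hx
  have hpow : ∀ m : ℕ, ‖(2 ^ m : ℕ) • u‖ < δ / 3 := by
    intro m
    induction m with
    | zero => simpa using hun
    | succ m ih =>
      rw [pow_succ', mul_smul]
      refine hdouble _ (H.nsmul_mem hx (2 ^ m)) _ (Submodule.smul_of_tower_mem _ _ hu) ?_ ih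
      rw [map_nsmul, ← nsmul_sub]
      exact Γ.nsmul_mem hxu _
  have hu0 : u = 0 := by
    by_contra hne
    obtain ⟨m, hm⟩ := pow_unbounded_of_one_lt (δ / 3 / ‖u‖) one_lt_two
    rw [div_lt_iff₀ (norm_pos_iff.2 hne)] at hm
    have := hpow m
    rw [← Nat.cast_smul_eq_nsmul ℝ, norm_smul] at this
    simp at this
    linarith
  simpa [hu0] using hxu

/-- A preconnected subset of a disconnected compact set cannot be arbitrarily dense in it. -/
theorem IsCompact.exists_isPreconnected_of_dense {X : Type*} [MetricSpace X] {K : Set X}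
    (hK : IsCompact K) :
    ∃ r > 0, ∀ S ⊆ K, IsPreconnected S → (∀ y ∈ K, ∃ x ∈ S, dist y x < r) → IsPreconnected K := by
  by_cases h : IsPreconnected K
  · exact ⟨1, one_pos, fun _ _ _ _ => h⟩
  rw [isPreconnected_closed_iff] at h
  push Not at h
  obtain ⟨t, t', ht, ht', hcov, ⟨a, ha⟩, ⟨b, hb⟩, hdisj⟩ := h
  obtain ⟨r, hr, hthick⟩ := Disjoint.exists_thickenings (s := K ∩ t) (t := K ∩ t')
    (Set.disjoint_iff_inter_eq_empty.2 (by rw [← Set.inter_inter_distrib_left, hdisj]))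
    (hK.inter_right ht) (hK.inter_right ht').isClosed
  -- An `r`-dense S meets both disjoint thickenings, which its connectedness forbids.
  refine ⟨r, hr, fun S hSK hS hdense => ?_⟩
  have hS' : S ⊆ Metric.thickening r (K ∩ t) ∪ Metric.thickening r (K ∩ t') := fun x hx =>
    (hcov (hSK hx)).imp (fun h => Metric.self_subset_thickening hr _ ⟨hSK hx, h⟩)
      (fun h => Metric.self_subset_thickening hr _ ⟨hSK hx, h⟩)
  obtain ⟨x, hx, hax⟩ := hdense a ha.1
  obtain ⟨y, hy, hby⟩ := hdense b hb.1
  have hxa : x ∈ Metric.thickening r (K ∩ t) :=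
    Metric.mem_thickening_iff.2 ⟨a, ha, by rwa [dist_comm]⟩
  have hyb : y ∈ Metric.thickening r (K ∩ t') :=
    Metric.mem_thickening_iff.2 ⟨b, hb, by rwa [dist_comm]⟩
  rcases hS.subset_or_subset Metric.isOpen_thickening Metric.isOpen_thickening hthick hS' with h | h
  · exact (Set.disjoint_left.1 hthick (h hy) hyb).elim
  · exact (Set.disjoint_left.1 hthick hxa (h hx)).elim

/-! ### Dimension and volume -/

theorem tangentSubspace_mono {n : ℕ} {Δ Γ : AddSubgroup (Torus n)} (h : Δ ≤ Γ) :
    tangentSubspace Δ ≤ tangentSubspace Γ := fun _ hv t => h (hv t)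

theorem torusDim_mono {n : ℕ} {Δ Γ : AddSubgroup (Torus n)} (h : Δ ≤ Γ) :
    torusDim Δ ≤ torusDim Γ := Submodule.finrank_mono (tangentSubspace_mono h)

theorem LipschitzWith.euclideanHausdorffMeasure_image_le {X Y : Type*} [EMetricSpace X]
    [EMetricSpace Y] [MeasurableSpace X] [BorelSpace X] [MeasurableSpace Y] [BorelSpace Y]
    {f : X → Y} (hf : LipschitzWith 1 f) (d : ℕ) (s : Set X) : μHE[d] (f '' s) ≤ μHE[d] s := by
  simp only [MeasureTheory.Measure.euclideanHausdorffMeasure_def,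
    MeasureTheory.Measure.smul_apply]
  gcongr
  simpa using hf.hausdorffMeasure_image_le (Nat.cast_nonneg d) s

theorem euclideanHausdorffMeasure_submodule_ball_lt_top {n : ℕ}
    (V : Submodule ℝ (EuclideanSpace ℝ (Fin n))) (δ : ℝ) :
    μHE[Module.finrank ℝ V] ((V : Set (EuclideanSpace ℝ (Fin n))) ∩ Metric.ball 0 δ) < ⊤ := by
  have himage : (V : Set (EuclideanSpace ℝ (Fin n))) ∩ Metric.ball 0 δ =
      (Subtype.val : V → _) '' Metric.ball 0 δ := by
    ext v
    simp [and_comm]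
  rw [himage, isometry_subtype_coe.euclideanHausdorffMeasure_image]
  exact Metric.isBounded_ball.measure_lt_top

/-- A closed subgroup of the torus has finite volume in its own dimension. -/
theorem torusVol_torusDim_lt_top {n : ℕ} {Γ : AddSubgroup (Torus n)}
    (hΓ : IsClosed (Γ : Set (Torus n))) : torusVol (torusDim Γ) Γ < ⊤ := by
  obtain ⟨δ, hδ, hloc⟩ := exists_ball_subset_tangentSubspace hΓ
  -- By compactness local finiteness suffices; locally Γ is covered by a 1-Lipschitz image of a ball
  -- in its tangent space.
  refine hΓ.isCompact.measure_lt_top_of_nhdsWithin fun x hx =>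
    ⟨Γ ∩ Metric.ball x δ, inter_mem_nhdsWithin _ (Metric.ball_mem_nhds x hδ), ?_⟩
  have hsub : (Γ : Set (Torus n)) ∩ Metric.ball x δ ⊆ (fun v => x + torusProj n v) ''
      ((tangentSubspace Γ : Set (EuclideanSpace ℝ (Fin n))) ∩ Metric.ball 0 δ) := by
    rintro y ⟨hy, hyx⟩
    obtain ⟨v, hv, hvn⟩ := exists_torusProj_eq_norm_eq (y - x)
    rw [Metric.mem_ball, dist_eq_norm, ← hvn] at hyx
    exact ⟨v, ⟨hloc v (hv ▸ Γ.sub_mem hy hx) hyx, by simpa using hyx⟩, by simp [hv]⟩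
  have hlip : LipschitzWith 1 fun v => x + torusProj n v :=
    LipschitzWith.of_dist_le_mul fun v w => by
      simpa using (lipschitzWith_torusProj n).dist_le_mul v w
  exact ((MeasureTheory.measure_mono hsub).trans
    (hlip.euclideanHausdorffMeasure_image_le _ _)).trans_lt
      (euclideanHausdorffMeasure_submodule_ball_lt_top _ δ)

/-! ### Compactness in the Hausdorff distance -/

/-- Closed subgroups close enough to `Γ` in the Hausdorff distance are contained in `Γ`, and if
one of them is a subtorus, then so is `Γ`. -/
theorem exists_radius_of_isClosed {n : ℕ} {Γ : AddSubgroup (Torus n)}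
    (hΓ : IsClosed (Γ : Set (Torus n))) :
    ∃ r > 0, ∀ Δ : AddSubgroup (Torus n), (∀ x ∈ Δ, ∃ y ∈ Γ, dist x y < r) → IsEpsDense r Δ Γ →
      Δ ≤ Γ ∧ (IsSubtorus Δ → IsSubtorus Γ) := by
  obtain ⟨r₁, hr₁, h₁⟩ := exists_forall_le_of_near hΓ
  obtain ⟨r₂, hr₂, h₂⟩ := hΓ.isCompact.exists_isPreconnected_of_dense
  refine ⟨min r₁ r₂, lt_min hr₁ hr₂, fun Δ hnear hdense => ?_⟩
  have hle : Δ ≤ Γ := h₁ Δ fun x hx =>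
    (hnear x hx).imp fun y hy => ⟨hy.1, hy.2.trans_le (min_le_left _ _)⟩
  refine ⟨hle, fun hΔ => ⟨hΓ, ⟨0, Γ.zero_mem⟩, h₂ Δ hle hΔ.2.isPreconnected fun y hy => ?_⟩⟩
  exact (hdense y hy).imp fun x hx => ⟨hx.1, hx.2.trans_le (min_le_right _ _)⟩

/-- The compact subgroups form a closed set for the Hausdorff distance. -/
theorem isClosed_setOf_coe_addSubgroup (G : Type*) [NormedAddCommGroup G] :
    IsClosed {K : NonemptyCompacts G | ∃ H : AddSubgroup G, (H : Set G) = K} := by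
  have hedist (K K' : NonemptyCompacts G) : Metric.hausdorffEDist (K : Set G) K' ≠ ⊤ :=
    Metric.hausdorffEDist_ne_top_of_nonempty_of_bounded K.nonempty K'.nonempty
      K.isCompact.isBounded K'.isCompact.isBounded
  rw [← isSeqClosed_iff_isClosed]
  intro S K hS hlim
  have hsub : ∀ x ∈ K, ∀ y ∈ K, x - y ∈ K := by
    intro x hx y hy
    refine K.isCompact.isClosed.closure_subset (Metric.mem_closure_iff.2 fun ε hε => ?_)
    obtain ⟨j, hj⟩ := (Metric.tendsto_nhds.1 hlim (ε / 3) (by positivity)).exists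
    obtain ⟨H, hH⟩ := hS j
    have hj' : Metric.hausdorffDist (K : Set G) (S j) < ε / 3 := by
      rwa [dist_comm, Metric.NonemptyCompacts.dist_eq] at hj
    obtain ⟨x', hx', hxx'⟩ := Metric.exists_dist_lt_of_hausdorffDist_lt hx hj' (hedist _ _)
    obtain ⟨y', hy', hyy'⟩ := Metric.exists_dist_lt_of_hausdorffDist_lt hy hj' (hedist _ _)
    have hmem : x' - y' ∈ (S j : Set G) := by
      rw [← hH] at hx' hy' ⊢
      exact H.sub_mem hx' hy'
    rw [Metric.hausdorffDist_comm] at hj'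
    obtain ⟨z, hz, hzd⟩ := Metric.exists_dist_lt_of_hausdorffDist_lt hmem hj' (hedist _ _)
    refine ⟨z, hz, ?_⟩
    have h1 := dist_triangle (x - y) (x' - y') z
    have h2 := dist_sub_sub_le x y x' y'
    linarith
  exact ⟨AddSubgroup.ofSub (K : Set G) K.nonempty fun x hx y hy => by
    rw [← sub_eq_add_neg]
    exact hsub x hx y hy, rfl⟩

/-- Finitely many closed subgroups approximate all closed subgroups of the torus from above. -/
theorem exists_finset_approximating (n : ℕ) {ε : ℝ} (hε : 0 < ε) :
    ∃ L : Finset (AddSubgroup (Torus n)), (∀ Γ ∈ L, IsClosed (Γ : Set (Torus n))) ∧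
      ∀ Δ : AddSubgroup (Torus n), IsClosed (Δ : Set (Torus n)) →
        ∃ Γ ∈ L, Δ ≤ Γ ∧ IsEpsDense ε Δ Γ ∧ (IsSubtorus Δ → IsSubtorus Γ) := by
  classical
  let T : {Γ : AddSubgroup (Torus n) // IsClosed (Γ : Set (Torus n))} →
      NonemptyCompacts (Torus n) := fun Γ => ⟨⟨Γ.1, Γ.2.isCompact⟩, ⟨0, Γ.1.zero_mem⟩⟩
  choose r hr hrad using fun Γ : {Γ : AddSubgroup (Torus n) // IsClosed (Γ : Set (Torus n))} =>
    exists_radius_of_isClosed Γ.2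
  obtain ⟨t, ht⟩ := (isClosed_setOf_coe_addSubgroup (Torus n)).isCompact.elim_finite_subcover
    (fun Γ => Metric.ball (T Γ) (min ε (r Γ))) (fun _ => Metric.isOpen_ball) (by
      rintro K ⟨H, hH⟩
      have hHc : IsClosed (H : Set (Torus n)) := hH ▸ K.isCompact.isClosed
      refine Set.mem_iUnion.2 ⟨⟨H, hHc⟩, ?_⟩
      have : K = T ⟨H, hHc⟩ := SetLike.coe_injective hH.symm
      rw [this]
      exact Metric.mem_ball_self (lt_min hε (hr _)))
  refine ⟨t.image Subtype.val, ?_, fun Δ hΔ => ?_⟩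
  · intro Γ hΓ
    obtain ⟨Γ', -, rfl⟩ := Finset.mem_image.1 hΓ
    exact Γ'.2
  obtain ⟨Γ, hΓt, hdist⟩ := Set.mem_iUnion₂.1 (ht (show T ⟨Δ, hΔ⟩ ∈ _ from ⟨Δ, rfl⟩))
  rw [Metric.mem_ball, Metric.NonemptyCompacts.dist_eq] at hdist
  have hne : Metric.hausdorffEDist (T ⟨Δ, hΔ⟩ : Set (Torus n)) (T Γ) ≠ ⊤ :=
    Metric.hausdorffEDist_ne_top_of_nonempty_of_bounded (T _).nonempty (T _).nonempty
      (T _).isCompact.isBounded (T _).isCompact.isBounded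
  have hnear : ∀ x ∈ Δ, ∃ y ∈ Γ.1, dist x y < r Γ := fun x hx =>
    Metric.exists_dist_lt_of_hausdorffDist_lt (s := (T ⟨Δ, hΔ⟩ : Set (Torus n))) hx
      (hdist.trans_le (min_le_right _ _)) hne
  have hdense : IsEpsDense (min ε (r Γ)) Δ Γ.1 := fun y hy => by
    rw [Metric.hausdorffDist_comm] at hdist
    rw [Metric.hausdorffEDist_comm] at hne
    exact Metric.exists_dist_lt_of_hausdorffDist_lt (s := (T Γ : Set (Torus n))) hy hdist hne
  obtain ⟨hle, htor⟩ := hrad Γ Δ hnear fun y hy =>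
    (hdense y hy).imp fun x hx => ⟨hx.1, hx.2.trans_le (min_le_right _ _)⟩
  exact ⟨Γ.1, Finset.mem_image_of_mem _ hΓt, hle, fun y hy =>
    (hdense y hy).imp fun x hx => ⟨hx.1, hx.2.trans_le (min_le_left _ _)⟩, htor⟩

theorem lemma4p4 (n k : ℕ) (hk : k ≤ n) (ε : ℝ) (hε : 0 < ε) :
    ∃ C : ℝ, 0 < C ∧ ∃ L : Finset (AddSubgroup (Torus n)),
      (∀ Γ ∈ L, IsClosed (Γ : Set (Torus n))) ∧
      (k < n → ∀ Γ ∈ L, k + 1 ≤ torusDim Γ) ∧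
      ∀ Δ : AddSubgroup (Torus n), IsClosed (Δ : Set (Torus n)) → torusDim Δ = k →
        torusVol k Δ ≤ ENNReal.ofReal C ∨
        ∃ Γ ∈ L, Δ ≤ Γ ∧ IsEpsDense ε Δ Γ ∧ (IsSubtorus Δ → IsSubtorus Γ) := by
  classical
  obtain ⟨L, hL, happrox⟩ := exists_finset_approximating n hε
  -- The 1 ensures positivity. Infinite volumes, possible only when dim Γ ≠ k, become 0 under
  -- `toReal`; the bound uses only terms with dim Γ = k. For k = n the filtered list is empty.
  refine ⟨1 + ∑ Γ ∈ L, (torusVol k Γ).toReal, by positivity, L.filter (k + 1 ≤ torusDim ·),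
    fun Γ hΓ => hL Γ (Finset.mem_filter.1 hΓ).1, fun _ Γ hΓ => (Finset.mem_filter.1 hΓ).2, ?_⟩
  rintro Δ hΔ rfl
  obtain ⟨Γ, hΓL, hle, hrest⟩ := happrox Δ hΔ
  rcases (torusDim_mono hle).lt_or_eq with hlt | heq
  · exact Or.inr ⟨Γ, Finset.mem_filter.2 ⟨hΓL, hlt⟩, hle, hrest⟩
  left
  have hfin : torusVol (torusDim Δ) Γ ≠ ⊤ := by
    rw [heq]
    exact (torusVol_torusDim_lt_top (hL Γ hΓL)).ne
  calc torusVol (torusDim Δ) Δ ≤ torusVol (torusDim Δ) Γ := MeasureTheory.measure_mono hle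
    _ = ENNReal.ofReal (torusVol (torusDim Δ) Γ).toReal := (ENNReal.ofReal_toReal hfin).symm
    _ ≤ _ := ENNReal.ofReal_le_ofReal <| (Finset.single_le_sum
        (f := fun Γ => (torusVol (torusDim Δ) Γ).toReal)
        (fun _ _ => ENNReal.toReal_nonneg) hΓL).trans (by linarith)
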